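/- Let $\mathcal T\subset\mathbb R^2$ be open, let $(e_1,e_2)$ be the canonical basis of $\mathbb R^2$, and let $X=(X(\boldsymbol t))_{\boldsymbol t\in\mathcal T}$ be a real-valued random field with $\mathbb E[X(\boldsymbol t)^2]<\infty$ for all $\boldsymbol t\in\mathcal T$. For $i=1,2$ put $$\theta^{(i)}_{\boldsymbol t}(\Delta)=\mathbb E\big[\{X(\boldsymbol t-\Delta e_i/2)-X(\boldsymbol t+\Delta e_i/2)\}^2\big]$$ whenever $\Delta>0$ and $\boldsymbol t\pm\Delta e_i/2\in\mathcal T$. Let $H_1,H_2:\mathcal T\to(0,1)$ be continuously differentiable, and let $\boldsymbol L=(L^{(1)}_1,L^{(1)}_2,L^{(2)}_1,L^{(2)}_2)$ have non-negative Lipschitz continuous components on $\mathcal T$. The field $X$ belongs to the class $\mathcal H^{H_1,H_2}$ (built with $\boldsymbol L$) if, for $i=1,2$, as $\Delta\downarrow0$, uniformly for $\boldsymbol t$ in compact subsets of $\mathcal T$, $$\theta^{(i)}_{\boldsymbol t}(\Delta)=L^{(i)}_1(\boldsymbol t)\Delta^{2H_1(\boldsymbol t)}+L^{(i)}_2(\boldsymbol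 t)\Delta^{2H_2(\boldsymbol t)}+o\big(\Delta^{2\max\{H_1(\boldsymbol t),H_2(\boldsymbol t)\}}\big).$$ **Lemma.** Let $X\in\mathcal H^{H_1,H_2}$ with $\boldsymbol L=(L_1,0,0,L_2)$, and let $\Delta_0>0$. Assume that for every $p\in\mathbb N$ and every compact $K\subset\mathcal T$ there is a constant $C_{p,K}$ such that $$\mathbb E\big[\{X(\boldsymbol t-\Delta e_i/2)-X(\boldsymbol t+\Delta e_i/2)\}^{2p}\big]\le C_{p,K}\,\big(\theta^{(i)}_{\boldsymbol t}(\Delta)\big)^{p}$$ for $i=1,2$, all $\boldsymbol t\in K$ and all $0<\Delta\le\Delta_0$ with $\boldsymbol t\pm\Delta e_i/2\in\mathcal T$. Then $X$ has a modification $Y$ on $\mathcal T$ such that almost every realization of $Y$ has the following property: for all $\boldsymbol t\in\mathcal T$, $i=1,2$ and $0\le\alpha<H_i(\boldsymbol t)$, the realization is $\alpha$-Hölder continuous in the direction $e_i$ near $\boldsymbol t$, that is, there are $r>0$ and $C$ (depending on the realization) with $$|Y(\boldsymbol s+ue_i)-Y(\boldsymbol s)|\le C|u|^{\alpha}\qquad\text{whenever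 } \boldsymbol s,\ \boldsymbol s+ue_i\in B(\boldsymbol t,r)\cap\mathcal T .$$ If almost every realization of $X$ is continuous on $\mathcal T$, then almost every realization of $X$ itself has this property. -/

import Mathlib

open MeasureTheory Set

noncomputable section

namespace LocalRegularity

/-- The plane, with its Euclidean norm. -/
abbrev Plane : Type := EuclideanSpace ℝ (Fin 2)

/-- The canonical basis vectors `e_1`, `e_2` of the plane (indexed by `0`, `1`). -/
def e (i : Fin 2) : Plane := EuclideanSpace.single i (1 : ℝ)

/-- The increment of the field `X` in direction `e_i`, of length `Δ`, centred at `t`: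
`X(t - Δ e_i / 2) - X(t + Δ e_i / 2)`. -/
def increment {Ω : Type*} (X : Plane → Ω → ℝ) (i : Fin 2) (t : Plane) (Δ : ℝ) (ω : Ω) : ℝ :=
  X (t - (Δ / 2) • e i) ω - X (t + (Δ / 2) • e i) ω

/-- Both end points of the centred increment lie in the domain. -/
def Admissible (T : Set Plane) (i : Fin 2) (t : Plane) (Δ : ℝ) : Prop :=
  t - (Δ / 2) • e i ∈ T ∧ t + (Δ / 2) • e i ∈ T

/-- The mean squared increment `θ_t^{(i)}(Δ)`. -/
def theta {Ω : Type*} [MeasurableSpace Ω] (P : Measure Ω) (X : Plane → Ω → ℝ)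
    (i : Fin 2) (t : Plane) (Δ : ℝ) : ℝ :=
  ∫ ω, (increment X i t Δ ω) ^ 2 ∂P

/-- The class `𝓗^{H₁,H₂}(L, T)` of second order random fields on `T` with local regularity
exponents `H₁, H₂` in quadratic mean. The function `L i j` is the coefficient of `Δ ^ (2 H_j)` in
the expansion of the mean squared increment in direction `e_i`, so that the vector `L` is
`(L 0 0, L 0 1, L 1 0, L 1 1)`. The remainder is of smaller order than both powers, uniformly for
`t` in compact subsets of `T`. -/
structure MemClass {Ω : Type*} [MeasurableSpace Ω] (P : Measure Ω) (T : Set Plane)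
    (H : Fin 2 → Plane → ℝ) (L : Fin 2 → Fin 2 → Plane → ℝ) (X : Plane → Ω → ℝ) : Prop where
  memLp : ∀ t ∈ T, MemLp (X t) 2 P
  H_mem : ∀ i, ∀ t ∈ T, H i t ∈ Ioo (0 : ℝ) 1
  H_contDiffOn : ∀ i, ContDiffOn ℝ 1 (H i) T
  L_nonneg : ∀ i j, ∀ t ∈ T, 0 ≤ L i j t
  L_lipschitz : ∀ i j, ∃ κ : NNReal, LipschitzOnWith κ (L i j) T
  expansion : ∀ i, ∀ K ⊆ T, IsCompact K → ∀ ε > 0, ∃ δ > 0, ∀ t ∈ K, ∀ Δ ∈ Ioc (0 : ℝ) δ,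
    Admissible T i t Δ →
      |theta P X i t Δ - (L i 0 t * Δ ^ (2 * H 0 t) + L i 1 t * Δ ^ (2 * H 1 t))|
        ≤ ε * Δ ^ (2 * max (H 0 t) (H 1 t))

/-- For every `p`, the `2p`-th moments of the directional increments of length at most `Δ₀` are
bounded by a constant times the `p`-th powers of their second moments; the constant is independent
of `Δ`, and locally uniform in `t`. The moment on the left is an extended nonnegative number, so
its finiteness is part of the condition. -/
def MomentsComparable {Ω : Type*} [MeasurableSpace Ω] (P : Measure Ω) (T : Set Plane)
    (Δ₀ : ℝ) (X : Plane → Ω → ℝ) : Prop :=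
  ∀ p : ℕ, ∀ K ⊆ T, IsCompact K → ∃ C : ℝ, ∀ i, ∀ t ∈ K, ∀ Δ ∈ Ioc (0 : ℝ) Δ₀,
    Admissible T i t Δ →
      ∫⁻ ω, ENNReal.ofReal ((increment X i t Δ ω) ^ (2 * p)) ∂P
        ≤ ENNReal.ofReal (C * (theta P X i t Δ) ^ p)

/-- The surface `f`, defined on `T`, is `α`-Hölder in direction `e_i` in a neighbourhood of `t`. -/
def LocallyHolderInDirection (T : Set Plane) (f : Plane → ℝ) (i : Fin 2) (α : ℝ)
    (t : Plane) : Prop :=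
  ∃ r > 0, ∃ C : ℝ, ∀ s ∈ Metric.ball t r ∩ T, ∀ u : ℝ, s + u • e i ∈ Metric.ball t r ∩ T →
    |f (s + u • e i) - f s| ≤ C * |u| ^ α

end LocalRegularity

end

namespace LocalRegularity

open Filter Topology

/-! Since the cross coefficients vanish, the mean squared increment in direction $e_i$ is
$O(\Delta^{2h})$ wherever $h\le H_i$, and all even moments follow by comparability. Moments of every
order beat any exponential growth in the number of variables (`ae_exists_forall_abs_le_geometric`),
so increments over polynomially many pairs of points, in terms of $2^n$, are controlled
simultaneously.

Ordinary dyadic chaining moves in both directions and so only sees the smaller exponent. To reach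
the exponent of direction $e_i$ itself, increments of length about $2^{-n}$ are taken between points
of the much finer grid of mesh $2^{-An}$ (`MemClass.ae_gridHolder`). Their number is still
exponential in $n$. Chaining with a poor rate $g<1$ costs only $g^{An}$ from that grid to the limit,
and this is at most $2^{-\alpha n}$ once $A$ is large (`dyadicLimitHolder_of_gridHolder`).

The modification is the limit of $X$ along dyadic corners. It agrees with $X$ almost surely at each
fixed point (`MemClass.ae_tendsto_dyadicFloor`), and everywhere if the path is continuous. Countably
many balls and rational exponents give all $\boldsymbol t$ and $\alpha$ at once. -/

/-! ### Moments and almost sure geometric bounds. -/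

/-- If all even moments of order `2p` of finitely many (at most `D * B ^ n`) random variables at
level `n` are `O((β ^ n) ^ (2p))`, then almost surely these variables are `O(g ^ n)`, for `β < g`. -/
theorem ae_exists_forall_abs_le_geometric {Ω ι : Type*} [MeasurableSpace Ω] {P : Measure Ω}
    (Z : ℕ → ι → Ω → ℝ) (F : ℕ → Finset ι)
    (hZ : ∀ n, ∀ k ∈ F n, AEMeasurable (Z n k) P)
    {D B β g : ℝ} (hB : 0 < B) (hcard : ∀ n, ((F n).card : ℝ) ≤ D * B ^ n)
    (hβ : 0 < β) (hβg : β < g)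
    (hmom : ∀ p : ℕ, p ≠ 0 → ∃ C : ℝ, 0 ≤ C ∧ ∀ n, ∀ k ∈ F n,
      ∫⁻ ω, ENNReal.ofReal ((Z n k ω) ^ (2 * p)) ∂P ≤ ENNReal.ofReal (C * (β ^ n) ^ (2 * p))) :
    ∀ᵐ ω ∂P, ∃ M : ℝ, 0 ≤ M ∧ ∀ n, ∀ k ∈ F n, |Z n k ω| ≤ M * g ^ n := by
  have hg : 0 < g := hβ.trans hβg
  have hq0 : 0 < β / g := div_pos hβ hg
  have hq1 : β / g < 1 := (div_lt_one hg).2 hβg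
  -- The order $2p$ is taken so large that the moment decay beats the growth $B^n$ of the number of
  -- variables.
  obtain ⟨p, hp0, hp⟩ : ∃ p : ℕ, p ≠ 0 ∧ B * (β / g) ^ (2 * p) < 1 := by
    obtain ⟨p, hp⟩ := exists_pow_lt_of_lt_one (inv_pos.2 hB) hq1
    refine ⟨p + 1, by omega, ?_⟩
    have h1 : (β / g) ^ (2 * (p + 1)) ≤ (β / g) ^ p :=
      pow_le_pow_of_le_one hq0.le hq1.le (by omega)
    calc B * (β / g) ^ (2 * (p + 1)) ≤ B * (β / g) ^ p := by gcongr
      _ < B * B⁻¹ := by gcongr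
      _ = 1 := mul_inv_cancel₀ hB.ne'
  obtain ⟨C, hC0, hC⟩ := hmom p hp0
  set ρ : ℝ := B * (β / g) ^ (2 * p) with hρ
  have hρ0 : 0 ≤ ρ := by positivity
  let S : ℕ → Ω → ENNReal := fun n ω =>
    ∑ k ∈ F n, ENNReal.ofReal ((Z n k ω / g ^ n) ^ (2 * p))
  have hmeas : ∀ n, ∀ k ∈ F n,
      AEMeasurable (fun ω => ENNReal.ofReal ((Z n k ω / g ^ n) ^ (2 * p))) P := fun n k hk =>
    (((hZ n k hk).div_const _).pow_const _).ennreal_ofReal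
  have hSm : ∀ n, AEMeasurable (S n) P := fun n =>
    Finset.aemeasurable_fun_sum _ (hmeas n)
  have hSn : ∀ n, ∫⁻ ω, S n ω ∂P ≤ ENNReal.ofReal (D * C * ρ ^ n) := by
    intro n
    have hterm : ∀ k ∈ F n, ∫⁻ ω, ENNReal.ofReal ((Z n k ω / g ^ n) ^ (2 * p)) ∂P
        ≤ ENNReal.ofReal (C * ((β / g) ^ (2 * p)) ^ n) := by
      intro k hk
      have h1 : ∀ ω, ENNReal.ofReal ((Z n k ω / g ^ n) ^ (2 * p))
          = ENNReal.ofReal (((g ^ n) ^ (2 * p))⁻¹) * ENNReal.ofReal ((Z n k ω) ^ (2 * p)) := by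
        intro ω
        rw [← ENNReal.ofReal_mul (by positivity), div_pow, div_eq_inv_mul]
      simp_rw [h1]
      rw [lintegral_const_mul' _ _ ENNReal.ofReal_ne_top]
      calc _ ≤ ENNReal.ofReal (((g ^ n) ^ (2 * p))⁻¹) * ENNReal.ofReal (C * (β ^ n) ^ (2 * p)) := by
            gcongr; exact hC n k hk
        _ = _ := by
          rw [← ENNReal.ofReal_mul (by positivity)]
          congr 1
          rw [div_pow, div_pow, ← pow_mul, ← pow_mul, ← pow_mul, ← pow_mul, mul_comm n]
          field_simp
    calc ∫⁻ ω, S n ω ∂P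
        = ∑ k ∈ F n, ∫⁻ ω, ENNReal.ofReal ((Z n k ω / g ^ n) ^ (2 * p)) ∂P :=
          lintegral_finsetSum' _ (hmeas n)
      _ ≤ ∑ _k ∈ F n, ENNReal.ofReal (C * ((β / g) ^ (2 * p)) ^ n) := Finset.sum_le_sum hterm
      _ = ENNReal.ofReal (((F n).card : ℝ) * (C * ((β / g) ^ (2 * p)) ^ n)) := by
          rw [Finset.sum_const, nsmul_eq_mul, ENNReal.ofReal_mul (Nat.cast_nonneg _),
            ENNReal.ofReal_natCast]
      _ ≤ _ := by
          apply ENNReal.ofReal_le_ofReal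
          calc ((F n).card : ℝ) * (C * ((β / g) ^ (2 * p)) ^ n)
              ≤ (D * B ^ n) * (C * ((β / g) ^ (2 * p)) ^ n) := by gcongr; exact hcard n
            _ = _ := by rw [hρ, mul_pow]; ring
  have hfin : ∫⁻ ω, ∑' n, S n ω ∂P ≠ ⊤ := by
    rw [lintegral_tsum hSm]
    refine ne_top_of_le_ne_top ?_ (ENNReal.tsum_le_tsum hSn)
    exact ((summable_geometric_of_lt_one hρ0 hp).mul_left (D * C)).tsum_ofReal_ne_top
  filter_upwards [ae_lt_top' (AEMeasurable.tsum hSm) hfin] with ω hω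
  -- The summand 1 makes the bound at least 1, hence no larger than its own $2p$-th power.
  refine ⟨1 + (∑' n, S n ω).toReal, by positivity, fun n k hk => ?_⟩
  have h1 : ENNReal.ofReal ((Z n k ω / g ^ n) ^ (2 * p)) ≤ ∑' n, S n ω :=
    (Finset.single_le_sum (f := fun k => ENNReal.ofReal ((Z n k ω / g ^ n) ^ (2 * p)))
      (fun _ _ => zero_le) hk).trans (ENNReal.le_tsum n)
  have h2 : (Z n k ω / g ^ n) ^ (2 * p) ≤ (∑' n, S n ω).toReal :=
    (ENNReal.ofReal_le_iff_le_toReal hω.ne).1 h1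
  set R := (∑' n, S n ω).toReal
  have hR : 0 ≤ R := ENNReal.toReal_nonneg
  rw [← div_le_iff₀ (by positivity)]
  by_contra! hlt
  have h3 : 1 + R ≤ (1 + R) ^ (2 * p) := le_self_pow₀ (by linarith) (by omega)
  have h4 : (1 + R) ^ (2 * p) ≤ (|Z n k ω| / g ^ n) ^ (2 * p) := by gcongr
  have h5 : (|Z n k ω| / g ^ n) ^ (2 * p) = (Z n k ω / g ^ n) ^ (2 * p) := by
    rw [div_pow, div_pow, (even_two_mul p).pow_abs]
  linarith

/-! ### Moment bounds for directional increments. -/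

section Moments

variable {Ω : Type*} [MeasurableSpace Ω] {P : Measure Ω} {T : Set Plane}
  {H : Fin 2 → Plane → ℝ} {L : Fin 2 → Fin 2 → Plane → ℝ} {X : Plane → Ω → ℝ}

theorem theta_nonneg (i : Fin 2) (t : Plane) (Δ : ℝ) : 0 ≤ theta P X i t Δ :=
  integral_nonneg fun _ => sq_nonneg _

/-- Only the power $\Delta^{2H_i}$ survives in direction $e_i$. The remainder has exponent
$2\max(H_1,H_2)\ge 2H_i$, so for $\Delta\le1$ both terms are dominated by $\Delta^{2h}$. -/
theorem MemClass.exists_theta_le (hX : MemClass P T H L X)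
    (hL : ∀ i j, i ≠ j → ∀ t ∈ T, L i j t = 0) {K : Set Plane} (hK : IsCompact K) (hKT : K ⊆ T)
    (i : Fin 2) {h : ℝ} (hh : ∀ s ∈ K, h ≤ H i s) :
    ∃ δ > 0, ∃ B : ℝ, 0 ≤ B ∧ ∀ t ∈ K, ∀ Δ ∈ Ioc (0 : ℝ) δ, Admissible T i t Δ →
      theta P X i t Δ ≤ B * (Δ ^ h) ^ 2 := by
  obtain ⟨δ, hδ, hexp⟩ := hX.expansion i K hKT hK 1 one_pos
  obtain ⟨κ, hκ⟩ := hX.L_lipschitz i i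
  obtain ⟨b, hb⟩ := hK.exists_bound_of_continuousOn (hκ.continuousOn.mono hKT)
  refine ⟨min δ 1, lt_min hδ one_pos, |b| + 1, by positivity, fun t ht Δ hΔ hadm => ?_⟩
  have hΔ0 : 0 < Δ := hΔ.1
  have hΔ1 : Δ ≤ 1 := hΔ.2.trans (min_le_right _ _)
  have h1 := hexp t ht Δ ⟨hΔ0, hΔ.2.trans (min_le_left _ _)⟩ hadm
  have h2 : L i 0 t * Δ ^ (2 * H 0 t) + L i 1 t * Δ ^ (2 * H 1 t) = L i i t * Δ ^ (2 * H i t) := by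
    fin_cases i
    · simp [hL 0 1 (by decide) t (hKT ht)]
    · simp [hL 1 0 (by decide) t (hKT ht)]
  rw [h2, one_mul] at h1
  have h3 : L i i t ≤ |b| := (le_abs_self _).trans ((hb t ht).trans (le_abs_self b))
  have h4 : (Δ ^ h) ^ 2 = Δ ^ (2 * h) := by
    rw [← Real.rpow_natCast, ← Real.rpow_mul hΔ0.le, mul_comm]; norm_num
  have h5 : Δ ^ (2 * H i t) ≤ Δ ^ (2 * h) :=
    Real.rpow_le_rpow_of_exponent_ge hΔ0 hΔ1 (by linarith [hh t ht])
  have h6 : Δ ^ (2 * max (H 0 t) (H 1 t)) ≤ Δ ^ (2 * h) := by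
    refine Real.rpow_le_rpow_of_exponent_ge hΔ0 hΔ1 ?_
    have : H i t ≤ max (H 0 t) (H 1 t) := by
      fin_cases i
      · exact le_max_left _ _
      · exact le_max_right _ _
    linarith [hh t ht]
  rw [h4]
  have h7 : L i i t * Δ ^ (2 * H i t) ≤ |b| * Δ ^ (2 * h) := by gcongr
  linarith [(abs_le.1 h1).2]

/-- Moments of directional increments between points of a compact convex set. -/
theorem MemClass.exists_moment_le (hX : MemClass P T H L X)
    (hL : ∀ i j, i ≠ j → ∀ t ∈ T, L i j t = 0) {Δ₀ : ℝ} (hΔ₀ : 0 < Δ₀)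
    (hmom : MomentsComparable P T Δ₀ X) {K : Set Plane} (hK : IsCompact K) (hKc : Convex ℝ K)
    (hKT : K ⊆ T) (i : Fin 2) {h : ℝ} (h0 : 0 < h) (hh : ∀ s ∈ K, h ≤ H i s) :
    ∃ δ > 0, ∀ p : ℕ, p ≠ 0 → ∃ C : ℝ, 0 ≤ C ∧ ∀ x ∈ K, ∀ u v : ℝ, x + u • e i ∈ K →
      |u| ≤ v → v ≤ δ →
      ∫⁻ ω, ENNReal.ofReal ((X (x + u • e i) ω - X x ω) ^ (2 * p)) ∂P
        ≤ ENNReal.ofReal (C * (v ^ h) ^ (2 * p)) := by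
  obtain ⟨δ, hδ, B, hB, hθ⟩ := hX.exists_theta_le hL hK hKT i hh
  refine ⟨min δ Δ₀, lt_min hδ hΔ₀, fun p hp => ?_⟩
  obtain ⟨C, hC⟩ := hmom p K hKT hK
  have key : ∀ x ∈ K, ∀ u v : ℝ, x + u • e i ∈ K → 0 < u → u ≤ v → v ≤ min δ Δ₀ →
      ∫⁻ ω, ENNReal.ofReal ((X (x + u • e i) ω - X x ω) ^ (2 * p)) ∂P
        ≤ ENNReal.ofReal ((|C| * B ^ p) * (v ^ h) ^ (2 * p)) := by
    intro x hx u v hxu hu huv hv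
    -- The hypotheses concern centred increments; convexity keeps the midpoint in `K`.
    set t : Plane := x + (u / 2) • e i with ht
    have e1 : t - (u / 2) • e i = x := by simp [ht]
    have e2 : t + (u / 2) • e i = x + u • e i := by
      rw [ht, add_assoc, ← add_smul]; congr 2; ring
    have htK : t ∈ K := by
      have := hKc hx hxu (by norm_num : (0 : ℝ) ≤ 1 / 2) (by norm_num : (0 : ℝ) ≤ 1 / 2)
        (by norm_num)
      convert this using 1
      rw [ht]; module
    have hadm : Admissible T i t u := ⟨by rw [e1]; exact hKT hx, by rw [e2]; exact hKT hxu⟩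
    have h1 := hC i t htK u ⟨hu, huv.trans (hv.trans (min_le_right _ _))⟩ hadm
    have h2 := hθ t htK u ⟨hu, huv.trans (hv.trans (min_le_left _ _))⟩ hadm
    have h3 : ∀ ω, (X (x + u • e i) ω - X x ω) ^ (2 * p) = (increment X i t u ω) ^ (2 * p) := by
      intro ω
      rw [increment, e1, e2, ← (even_two_mul p).pow_abs, abs_sub_comm, (even_two_mul p).pow_abs]
    simp_rw [h3]
    refine h1.trans (ENNReal.ofReal_le_ofReal ?_)
    have hθ0 := theta_nonneg (P := P) (X := X) i t u
    calc C * theta P X i t u ^ p ≤ |C| * (B * (u ^ h) ^ 2) ^ p := by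
          gcongr; exact le_abs_self C
      _ ≤ |C| * (B * (v ^ h) ^ 2) ^ p := by gcongr
      _ = _ := by rw [mul_pow, ← pow_mul]; ring
  refine ⟨|C| * B ^ p, by positivity, fun x hx u v hxu huv hv => ?_⟩
  rcases lt_trichotomy u 0 with hu | rfl | hu
  · have e3 : x + u • e i + (-u) • e i = x := by module
    have := key (x + u • e i) hxu (-u) v (by rwa [e3]) (by linarith)
      (by rwa [abs_of_neg hu] at huv) hv
    rw [e3] at this
    convert this using 4 with ω
    rw [← (even_two_mul p).pow_abs, abs_sub_comm, (even_two_mul p).pow_abs]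
  · have : 2 * p ≠ 0 := by omega
    simp [this]
  · exact key x hx u v hxu hu ((le_abs_self u).trans huv) hv

end Moments

/-! ### Simultaneous bounds for families of increments. -/

section Increments

variable {Ω : Type*} [MeasurableSpace Ω] {P : Measure Ω} {T : Set Plane}
  {H : Fin 2 → Plane → ℝ} {L : Fin 2 → Fin 2 → Plane → ℝ} {X : Plane → Ω → ℝ}

/-- Almost sure geometric bound for countably many directional increments. -/
theorem MemClass.ae_increment_le (hX : MemClass P T H L X)
    (hL : ∀ i j, i ≠ j → ∀ t ∈ T, L i j t = 0) {Δ₀ : ℝ} (hΔ₀ : 0 < Δ₀)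
    (hmom : MomentsComparable P T Δ₀ X) {K : Set Plane} (hK : IsCompact K) (hKc : Convex ℝ K)
    (hKT : K ⊆ T) (i : Fin 2) {h : ℝ} (h0 : 0 < h) (hh : ∀ s ∈ K, h ≤ H i s)
    {g : ℝ} (hg : (1 / 2 : ℝ) ^ h < g) {ι : Type*} (F : ℕ → Finset ι)
    (x : ℕ → ι → Plane) (u : ℕ → ι → ℝ) {D B : ℝ} (hD : 0 ≤ D) (hB : 0 < B)
    (hcard : ∀ n, ((F n).card : ℝ) ≤ D * B ^ n)
    (hx : ∀ n, ∀ k ∈ F n, x n k ∈ K) (hxu : ∀ n, ∀ k ∈ F n, x n k + u n k • e i ∈ K)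
    (hu : ∀ n, ∀ k ∈ F n, |u n k| ≤ 2 * (1 / 2) ^ n) :
    ∀ᵐ ω ∂P, ∃ M : ℝ, ∃ N : ℕ, 0 ≤ M ∧ ∀ n, N ≤ n → ∀ k ∈ F n,
      |X (x n k + u n k • e i) ω - X (x n k) ω| ≤ M * g ^ n := by
  obtain ⟨δ, hδ, hmo⟩ := hX.exists_moment_le hL hΔ₀ hmom hK hKc hKT i h0 hh
  obtain ⟨N, hN⟩ := exists_pow_lt_of_lt_one (half_pos hδ) (by norm_num : (1 / 2 : ℝ) < 1)
  -- Levels whose increments may exceed the range `δ` of the moment bound are emptied.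
  let F' : ℕ → Finset ι := fun n => if N ≤ n then F n else ∅
  have hF' : ∀ n k, k ∈ F' n → N ≤ n ∧ k ∈ F n := by
    intro n k hk
    by_cases hn : N ≤ n
    · exact ⟨hn, by simpa [F', hn] using hk⟩
    · simp [F', hn] at hk
  have haem : ∀ y ∈ K, AEMeasurable (X y) P := fun y hy =>
    (hX.memLp y (hKT hy)).aestronglyMeasurable.aemeasurable
  have := ae_exists_forall_abs_le_geometric (P := P)
    (fun n k ω => X (x n k + u n k • e i) ω - X (x n k) ω) F'
    (fun n k hk => (haem _ (hxu n k (hF' n k hk).2)).sub (haem _ (hx n k (hF' n k hk).2)))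
    hB (β := (1 / 2 : ℝ) ^ h) (g := g)
    (fun n => by
      by_cases hn : N ≤ n
      · simpa [F', hn] using hcard n
      · simp only [F', hn, if_false, Finset.card_empty, Nat.cast_zero]; positivity)
    (by positivity) hg
    (fun p hp => by
      obtain ⟨C, hC, hb⟩ := hmo p hp
      refine ⟨C * ((2 : ℝ) ^ h) ^ (2 * p), by positivity, fun n k hk => ?_⟩
      obtain ⟨hn, hk⟩ := hF' n k hk
      have hv : 2 * (1 / 2 : ℝ) ^ n ≤ δ := by
        have : (1 / 2 : ℝ) ^ n ≤ (1 / 2) ^ N :=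
          pow_le_pow_of_le_one (by norm_num) (by norm_num) hn
        linarith
      refine (hb _ (hx n k hk) _ _ (hxu n k hk) (hu n k hk) hv).trans (le_of_eq ?_)
      rw [Real.mul_rpow (by norm_num) (by positivity), mul_pow, mul_assoc,
        ← Real.rpow_natCast (1 / 2 : ℝ) n, ← Real.rpow_mul (by norm_num), mul_comm (n : ℝ) h,
        Real.rpow_mul (by norm_num), Real.rpow_natCast])
  filter_upwards [this] with ω ⟨M, hM, hb⟩
  exact ⟨M, N, hM, fun n hn k hk => hb n k (by simpa [F', hn] using hk)⟩

theorem MemClass.exists_lt_forall_le (hX : MemClass P T H L X) {K : Set Plane} (hK : IsCompact K)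
    (hKT : K ⊆ T) (i : Fin 2) {a : ℝ} (ha : ∀ s ∈ K, a < H i s) :
    ∃ h, a < h ∧ ∀ s ∈ K, h ≤ H i s := by
  rcases K.eq_empty_or_nonempty with rfl | hne
  · exact ⟨a + 1, by linarith, by simp⟩
  · obtain ⟨s, hs, hmin⟩ := hK.exists_isMinOn hne ((hX.H_contDiffOn i).continuousOn.mono hKT)
    exact ⟨H i s, ha s hs, fun y hy => hmin hy⟩

end Increments

/-! ### Dyadic grids and increments between their points. -/

/-- Points of the dyadic grid of mesh `2 ^ (-m)`. -/
noncomputable def dyadicPoint (m : ℕ) (z : Fin 2 → ℤ) : Plane := WithLp.toLp 2 fun j => (z j : ℝ) / 2 ^ m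

/-- The lower left corner of the dyadic square of side `2 ^ (-m)` containing `s`. -/
noncomputable def dyadicFloor (m : ℕ) (s : Plane) : Plane := dyadicPoint m fun j => ⌊2 ^ m * s j⌋

@[simp] theorem dyadicPoint_apply (m : ℕ) (z : Fin 2 → ℤ) (j : Fin 2) :
    dyadicPoint m z j = (z j : ℝ) / 2 ^ m := rfl

theorem e_apply (i j : Fin 2) : e i j = if j = i then 1 else 0 := by
  simp [e]

theorem dist_le_of_forall_coord {x s : Plane} {κ : ℝ} (h : ∀ j, |x j - s j| ≤ κ) :
    dist x s ≤ 2 * κ := by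
  have hκ : 0 ≤ κ := (abs_nonneg _).trans (h 0)
  rw [EuclideanSpace.dist_eq, Fin.sum_univ_two, Real.dist_eq, Real.dist_eq]
  apply Real.sqrt_le_iff.2 ⟨by positivity, ?_⟩
  have h0 : |x 0 - s 0| ^ 2 ≤ κ ^ 2 := by gcongr; exact h 0
  have h1 : |x 1 - s 1| ^ 2 ≤ κ ^ 2 := by gcongr; exact h 1
  nlinarith [sq_nonneg κ]

theorem dist_dyadicPoint_le {m : ℕ} {z : Fin 2 → ℤ} {s : Plane} {κ : ℝ}
    (h : ∀ j, |(z j : ℝ) - 2 ^ m * s j| ≤ κ) :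
    dist (dyadicPoint m z) s ≤ 2 * κ * (1 / 2) ^ m := by
  have := dist_le_of_forall_coord (x := dyadicPoint m z) (s := s) (κ := κ * (1 / 2) ^ m)
    (fun j => by
      have h2 : (0 : ℝ) < 2 ^ m := by positivity
      have : dyadicPoint m z j - s j = ((z j : ℝ) - 2 ^ m * s j) * (1 / 2) ^ m := by
        rw [dyadicPoint_apply, one_div, inv_pow]; field_simp
      rw [this, abs_mul, abs_of_pos (a := (1 / 2 : ℝ) ^ m) (by positivity)]
      gcongr
      exact h j)
  linarith

theorem abs_floor_sub_le (a : ℝ) : |(⌊a⌋ : ℝ) - a| ≤ 1 := by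
  rw [abs_le]; constructor <;> linarith [Int.floor_le a, Int.lt_floor_add_one a]

theorem dist_dyadicFloor_le (m : ℕ) (s : Plane) :
    dist (dyadicFloor m s) s ≤ 2 * (1 / 2) ^ m := by
  have := dist_dyadicPoint_le (m := m) (s := s) (κ := 1) fun j => abs_floor_sub_le (2 ^ m * s j)
  rwa [mul_one] at this

theorem tendsto_dyadicFloor (s : Plane) : Tendsto (fun m => dyadicFloor m s) atTop (𝓝 s) := by
  rw [tendsto_iff_dist_tendsto_zero]
  refine squeeze_zero (fun _ => dist_nonneg) (fun m => dist_dyadicFloor_le m s) ?_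
  simpa using (tendsto_pow_atTop_nhds_zero_of_lt_one (by norm_num : (0 : ℝ) ≤ 1 / 2)
    (by norm_num)).const_mul 2

/-- Increments in direction `e_i` of length at most `2 * 2 ^ (-n)`, between points of the dyadic
grid of mesh `2 ^ (-A n)` in `K`, are `O(g ^ n)`. -/
def GridHolder (f : Plane → ℝ) (K : Set Plane) (i : Fin 2) (A : ℕ) (g : ℝ) : Prop :=
  ∃ M : ℝ, ∃ N : ℕ, 0 ≤ M ∧ ∀ n, N ≤ n → ∀ (z : Fin 2 → ℤ) (c : ℤ),
    dyadicPoint (A * n) z ∈ K → dyadicPoint (A * n) z + ((c : ℝ) / 2 ^ (A * n)) • e i ∈ K →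
    |(c : ℝ) / 2 ^ (A * n)| ≤ 2 * (1 / 2) ^ n →
    |f (dyadicPoint (A * n) z + ((c : ℝ) / 2 ^ (A * n)) • e i) - f (dyadicPoint (A * n) z)|
      ≤ M * g ^ n

/-- A bounded set contains $O(2^{3An})$ admissible triples (two coordinates and a step), whatever
`A` is. Compactness leaves room for an exponent strictly between `a` and $H_i$, which gives the
strict gap required by the moment argument. -/
theorem MemClass.ae_gridHolder {Ω : Type*} [MeasurableSpace Ω] {P : Measure Ω} {T : Set Plane}
    {H : Fin 2 → Plane → ℝ} {L : Fin 2 → Fin 2 → Plane → ℝ} {X : Plane → Ω → ℝ}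
    (hX : MemClass P T H L X)
    (hL : ∀ i j, i ≠ j → ∀ t ∈ T, L i j t = 0) {Δ₀ : ℝ} (hΔ₀ : 0 < Δ₀)
    (hmom : MomentsComparable P T Δ₀ X) {K : Set Plane} (hK : IsCompact K) (hKc : Convex ℝ K)
    (hKT : K ⊆ T) (i : Fin 2) {a : ℝ} (ha0 : 0 ≤ a) (ha : ∀ s ∈ K, a < H i s) (A : ℕ) :
    ∀ᵐ ω ∂P, GridHolder (fun s => X s ω) K i A ((1 / 2) ^ a) := by
  classical
  obtain ⟨h, hah, hh⟩ := hX.exists_lt_forall_le hK hKT i ha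
  obtain ⟨R, hR⟩ := hK.isBounded.exists_norm_le
  -- Large enough to bound both the coordinates of points of `K` and the steps, which have length at
  -- most 2.
  set N : ℕ := ⌈R⌉₊ + 2 with hNdef
  have hRN : R ≤ N := by rw [hNdef]; push_cast; linarith [Nat.le_ceil R]
  have hN2 : (2 : ℝ) ≤ N := by rw [hNdef]; push_cast; linarith [Nat.cast_nonneg (α := ℝ) ⌈R⌉₊]
  let W : ℕ → ℤ := fun n => N * 2 ^ (A * n)
  have hW1 : ∀ n, 1 ≤ W n := fun n => by
    have : (1 : ℤ) ≤ 2 ^ (A * n) := one_le_pow₀ (by norm_num)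
    have : (1 : ℤ) ≤ N := by omega
    simp only [W]; nlinarith
  let E : ℕ → Finset ((Fin 2 → ℤ) × ℤ) := fun n =>
    (Fintype.piFinset fun _ : Fin 2 => Finset.Icc (-W n) (W n)) ×ˢ Finset.Icc (-W n) (W n)
  let F : ℕ → Finset ((Fin 2 → ℤ) × ℤ) := fun n => (E n).filter fun k =>
    dyadicPoint (A * n) k.1 ∈ K ∧ dyadicPoint (A * n) k.1 + ((k.2 : ℝ) / 2 ^ (A * n)) • e i ∈ K ∧
    |(k.2 : ℝ) / 2 ^ (A * n)| ≤ 2 * (1 / 2) ^ n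
  have hcard : ∀ n, ((F n).card : ℝ) ≤ (27 * N ^ 3) * ((2 : ℝ) ^ (3 * A)) ^ n := by
    intro n
    have h1 : (F n).card ≤ (E n).card := Finset.card_filter_le _ _
    have h2 : (E n).card = (W n + 1 - -W n).toNat ^ 3 := by
      simp [E, Finset.card_product, Fintype.card_piFinset]; ring
    have h3 : ((W n + 1 - -W n).toNat : ℝ) ≤ 3 * (N * 2 ^ (A * n)) := by
      have : ((W n + 1 - -W n).toNat : ℤ) ≤ 3 * W n := by
        rw [Int.toNat_of_nonneg (by linarith [hW1 n])]; linarith [hW1 n]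
      have h4 : (((W n + 1 - -W n).toNat : ℤ) : ℝ) ≤ ((3 * W n : ℤ) : ℝ) := by exact_mod_cast this
      rw [Int.cast_natCast] at h4
      refine h4.trans (le_of_eq ?_)
      simp only [W]; push_cast; rfl
    calc ((F n).card : ℝ) ≤ (E n).card := by exact_mod_cast h1
      _ = ((W n + 1 - -W n).toNat : ℝ) ^ 3 := by rw [h2]; push_cast; rfl
      _ ≤ (3 * (N * 2 ^ (A * n))) ^ 3 := by gcongr
      _ = _ := by rw [mul_pow, mul_pow, ← pow_mul, ← pow_mul]; ring
  have key := hX.ae_increment_le hL hΔ₀ hmom hK hKc hKT i (ha0.trans_lt hah) hh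
    (Real.rpow_lt_rpow_of_exponent_gt (by norm_num : (0 : ℝ) < 1 / 2) (by norm_num) hah)
    F (fun n k => dyadicPoint (A * n) k.1) (fun n k => (k.2 : ℝ) / 2 ^ (A * n))
    (by positivity) (by positivity) hcard
    (fun n k hk => (Finset.mem_filter.1 hk).2.1)
    (fun n k hk => (Finset.mem_filter.1 hk).2.2.1)
    (fun n k hk => (Finset.mem_filter.1 hk).2.2.2)
  have hbd : ∀ n (c : ℤ), |(c : ℝ) / 2 ^ (A * n)| ≤ N → c ∈ Finset.Icc (-W n) (W n) := by
    intro n c hc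
    rw [abs_div, abs_of_pos (a := (2 : ℝ) ^ (A * n)) (by positivity),
      div_le_iff₀ (by positivity)] at hc
    have : |c| ≤ W n := by
      simp only [W]; exact_mod_cast hc
    exact Finset.mem_Icc.2 (abs_le.1 this)
  filter_upwards [key] with ω ⟨M, n₀, hM, hb⟩
  refine ⟨M, n₀, hM, fun n hn z c hz hzc hc => hb n hn (z, c) ?_⟩
  refine Finset.mem_filter.2 ⟨Finset.mem_product.2 ⟨Fintype.mem_piFinset.2 fun j => ?_, ?_⟩,
    hz, hzc, hc⟩
  · refine hbd n _ ?_
    have h1 := PiLp.norm_apply_le (dyadicPoint (A * n) z) j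
    rw [Real.norm_eq_abs, dyadicPoint_apply] at h1
    exact h1.trans ((hR _ hz).trans hRN)
  · refine hbd n _ (hc.trans ?_)
    have : (1 / 2 : ℝ) ^ n ≤ 1 := pow_le_one₀ (by norm_num) (by norm_num)
    linarith

theorem add_smul_e_apply (x : Plane) (v : ℝ) (i j : Fin 2) :
    (x + v • e i) j = x j + if j = i then v else 0 := by
  simp [e_apply]

/-! ### Chaining along dyadic corners. -/

/-- Passing from level `n` to level `n + 1` of the dyadic approximation. -/
theorem abs_sub_dyadicFloor_succ_le {f : Plane → ℝ} {K : Set Plane} {g M : ℝ} {N : ℕ} {s : Plane}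
    (hf : ∀ i, ∀ n, N ≤ n → ∀ (z : Fin 2 → ℤ) (c : ℤ),
      dyadicPoint n z ∈ K → dyadicPoint n z + ((c : ℝ) / 2 ^ n) • e i ∈ K →
      |(c : ℝ) / 2 ^ n| ≤ 2 * (1 / 2) ^ n →
      |f (dyadicPoint n z + ((c : ℝ) / 2 ^ n) • e i) - f (dyadicPoint n z)| ≤ M * g ^ n)
    {n : ℕ} (hn : N ≤ n + 1) (hK : ∀ x, dist x s ≤ 4 * (1 / 2) ^ (n + 1) → x ∈ K) :
    |f (dyadicFloor (n + 1) s) - f (dyadicFloor n s)| ≤ 2 * M * g ^ (n + 1) := by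
  -- The level `n` corner in level `n + 1` coordinates; each coordinate of the finer corner exceeds
  -- it by 0 or 1.
  set a : Fin 2 → ℤ := fun j => 2 * ⌊2 ^ n * s j⌋ with ha
  set b : Fin 2 → ℤ := fun j => ⌊2 ^ (n + 1) * s j⌋ with hb
  have hab : ∀ j, 0 ≤ b j - a j ∧ b j - a j ≤ 1 := by
    intro j
    have h1 := Int.floor_le (2 ^ n * s j)
    have h2 := Int.lt_floor_add_one (2 ^ n * s j)
    have h3 : a j ≤ b j := by
      refine Int.le_floor.2 ?_
      simp only [ha]; push_cast; rw [pow_succ]; linarith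
    have h4 : b j < a j + 2 := by
      refine Int.floor_lt.2 ?_
      simp only [ha]; push_cast; rw [pow_succ]; linarith
    omega
  -- The bend of the axis-parallel path between the two corners.
  set w : Fin 2 → ℤ := fun j => if j = 0 then b j else a j with hw
  have hb2 : ∀ j, |(b j : ℝ) - 2 ^ (n + 1) * s j| ≤ 2 := fun j =>
    (abs_floor_sub_le _).trans (by norm_num)
  have ha2 : ∀ j, |(a j : ℝ) - 2 ^ (n + 1) * s j| ≤ 2 := by
    intro j
    have h1 : (a j : ℝ) - 2 ^ (n + 1) * s j = 2 * ((⌊2 ^ n * s j⌋ : ℝ) - 2 ^ n * s j) := by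
      simp only [ha]; push_cast; ring
    rw [h1, abs_mul, abs_two]
    linarith [abs_floor_sub_le (2 ^ n * s j)]
  have hw2 : ∀ j, |(w j : ℝ) - 2 ^ (n + 1) * s j| ≤ 2 := by
    intro j
    by_cases hj : j = 0
    · simpa [hw, hj] using hb2 0
    · simpa only [hw, hj, if_false] using ha2 j
  have hmem : ∀ z : Fin 2 → ℤ, (∀ j, |(z j : ℝ) - 2 ^ (n + 1) * s j| ≤ 2) →
      dyadicPoint (n + 1) z ∈ K := fun z hz =>
    hK _ ((dist_dyadicPoint_le hz).trans (le_of_eq (by ring)))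
  have e0 : dyadicFloor n s = dyadicPoint (n + 1) a := by
    ext j
    simp only [dyadicFloor, dyadicPoint_apply, ha]
    push_cast; rw [pow_succ]; field_simp
  have hc : ∀ j, |((b j - a j : ℤ) : ℝ) / 2 ^ (n + 1)| ≤ 2 * (1 / 2) ^ (n + 1) := by
    intro j
    have h1 : (0 : ℝ) ≤ ((b j - a j : ℤ) : ℝ) := by exact_mod_cast (hab j).1
    have h2 : ((b j - a j : ℤ) : ℝ) ≤ 1 := by exact_mod_cast (hab j).2
    rw [abs_of_nonneg (by positivity), div_eq_mul_inv, one_div, inv_pow]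
    gcongr; linarith
  have e1 : dyadicPoint (n + 1) a + (((b 0 - a 0 : ℤ) : ℝ) / 2 ^ (n + 1)) • e 0
      = dyadicPoint (n + 1) w := by
    ext j
    rw [add_smul_e_apply]
    fin_cases j <;> simp [hw]; ring
  have e2 : dyadicPoint (n + 1) w + (((b 1 - a 1 : ℤ) : ℝ) / 2 ^ (n + 1)) • e 1
      = dyadicFloor (n + 1) s := by
    ext j
    rw [add_smul_e_apply]
    fin_cases j <;> simp [hw, hb, dyadicFloor]; ring
  have h1 := hf 0 (n + 1) hn a (b 0 - a 0) (hmem a ha2) (by rw [e1]; exact hmem w hw2) (hc 0)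
  have h2 := hf 1 (n + 1) hn w (b 1 - a 1) (hmem w hw2) (by rw [e2]; exact hmem b hb2) (hc 1)
  rw [e1, ← e0] at h1
  rw [e2] at h2
  calc |f (dyadicFloor (n + 1) s) - f (dyadicFloor n s)|
      ≤ |f (dyadicFloor (n + 1) s) - f (dyadicPoint (n + 1) w)|
        + |f (dyadicPoint (n + 1) w) - f (dyadicFloor n s)| := abs_sub_le _ _ _
    _ ≤ M * g ^ (n + 1) + M * g ^ (n + 1) := add_le_add h2 h1
    _ = _ := by ring

/-- Chaining: values at dyadic approximations converge geometrically. -/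
theorem exists_tendsto_dyadicFloor {f : Plane → ℝ} {q : Plane} {R g : ℝ} (hR : 0 < R)
    (hg0 : 0 ≤ g) (hg1 : g < 1) (hf : ∀ i, GridHolder f (Metric.closedBall q R) i 1 g) :
    ∃ M : ℝ, ∃ N : ℕ, 0 ≤ M ∧ ∀ s ∈ Metric.closedBall q (R / 2),
      (∃ l, Tendsto (fun n => f (dyadicFloor n s)) atTop (𝓝 l)) ∧
      ∀ l, Tendsto (fun n => f (dyadicFloor n s)) atTop (𝓝 l) → ∀ n, N ≤ n →
        |f (dyadicFloor n s) - l| ≤ M * g ^ n := by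
  simp only [GridHolder, one_mul] at hf
  choose M N hM hb using hf
  obtain ⟨N', hN'⟩ := exists_pow_lt_of_lt_one (div_pos hR (by norm_num : (0 : ℝ) < 8))
    (by norm_num : (1 / 2 : ℝ) < 1)
  set N₀ := max N' (max (N 0) (N 1)) with hN₀
  set M₀ := M 0 + M 1 with hM₀
  have hNi : ∀ i, N i ≤ N₀ := by
    intro i; fin_cases i <;> simp [hN₀]
  have hMi : ∀ i, M i ≤ M₀ := by
    intro i; fin_cases i <;> simp [hM₀, hM]
  have hM₀0 : 0 ≤ M₀ := add_nonneg (hM 0) (hM 1)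
  have hpos : 0 < 1 - g := by linarith
  refine ⟨2 * M₀ / (1 - g), N₀, by positivity, fun s hs => ?_⟩
  have hstep : ∀ n, N₀ ≤ n →
      |f (dyadicFloor (n + 1) s) - f (dyadicFloor n s)| ≤ 2 * M₀ * g ^ n := by
    intro n hn
    have := abs_sub_dyadicFloor_succ_le (f := f) (K := Metric.closedBall q R) (g := g) (M := M₀)
      (N := N₀) (s := s)
      (fun i n hn z c h1 h2 h3 => (hb i n ((hNi i).trans hn) z c h1 h2 h3).trans
        (by gcongr; exact hMi i)) (n := n) (by omega)
      (fun x hx => by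
        have h1 : (1 / 2 : ℝ) ^ (n + 1) ≤ (1 / 2) ^ N' :=
          pow_le_pow_of_le_one (by norm_num) (by norm_num)
            ((le_max_left _ _).trans (hn.trans (Nat.le_succ n)))
        rw [Metric.mem_closedBall] at hs ⊢
        linarith [dist_triangle x s q])
    refine this.trans ?_
    have : g ^ (n + 1) ≤ g ^ n := pow_le_pow_of_le_one hg0 hg1.le (Nat.le_succ n)
    gcongr
  have hsh : ∀ k, dist (f (dyadicFloor (k + N₀) s)) (f (dyadicFloor (k + 1 + N₀) s))
      ≤ 2 * M₀ * g ^ N₀ * g ^ k := by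
    intro k
    have := hstep (k + N₀) (Nat.le_add_left _ _)
    rw [dist_comm, Real.dist_eq, show k + 1 + N₀ = k + N₀ + 1 by ring]
    refine this.trans (le_of_eq ?_)
    rw [pow_add]; ring
  constructor
  · obtain ⟨l, hl⟩ := cauchySeq_tendsto_of_complete (cauchySeq_of_le_geometric _ _ hg1 hsh)
    exact ⟨l, (tendsto_add_atTop_iff_nat N₀).1 hl⟩
  · intro l hl n hn
    have := dist_le_of_le_geometric_of_tendsto _ _ hg1 hsh ((tendsto_add_atTop_iff_nat N₀).2 hl)
      (n - N₀)
    rw [Nat.sub_add_cancel hn, Real.dist_eq, mul_assoc, ← pow_add, Nat.add_sub_cancel' hn] at this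
    refine this.trans (le_of_eq ?_)
    ring

/-- On the ball of centre `q` and radius `R / 2`, the dyadic approximations of `f` converge, and
their limit is `α`-Hölder in direction `e_i`. -/
def DyadicLimitHolder (f : Plane → ℝ) (q : Plane) (R : ℝ) (i : Fin 2) (α : ℝ) : Prop :=
  (∀ s ∈ Metric.closedBall q (R / 2), ∃ l, Tendsto (fun n => f (dyadicFloor n s)) atTop (𝓝 l)) ∧
  ∃ M : ℝ, ∃ δ > 0, 0 ≤ M ∧ ∀ s ∈ Metric.closedBall q (R / 2), ∀ u : ℝ,
    s + u • e i ∈ Metric.closedBall q (R / 2) → u ≠ 0 → |u| ≤ δ → ∀ a b,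
    Tendsto (fun n => f (dyadicFloor n s)) atTop (𝓝 a) →
    Tendsto (fun n => f (dyadicFloor n (s + u • e i))) atTop (𝓝 b) →
    |b - a| ≤ M * |u| ^ α

/-- Both points are replaced by their corners at level $An$, where $2^{-n}$ is comparable to $|u|$.
The two corners differ by a multiple of $e_i$, so `hfA` bounds their increment, while `hgA` makes
the chaining errors of the same order. -/
theorem dyadicLimitHolder_of_gridHolder {f : Plane → ℝ} {q : Plane} {R g α : ℝ} (hR : 0 < R)
    (hg0 : 0 ≤ g) (hg1 : g < 1) (hf : ∀ i, GridHolder f (Metric.closedBall q R) i 1 g)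
    (i : Fin 2) {A : ℕ} (hA : 1 ≤ A) (hα : 0 ≤ α) (hgA : g ^ A ≤ (1 / 2) ^ α)
    (hfA : GridHolder f (Metric.closedBall q R) i A ((1 / 2) ^ α)) :
    DyadicLimitHolder f q R i α := by
  obtain ⟨M₁, N₁, hM₁, h₁⟩ := exists_tendsto_dyadicFloor hR hg0 hg1 hf
  obtain ⟨M₂, N₂, hM₂, h₂⟩ := hfA
  obtain ⟨N', hN'⟩ := exists_pow_lt_of_lt_one (div_pos hR (by norm_num : (0 : ℝ) < 4))
    (by norm_num : (1 / 2 : ℝ) < 1)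
  set N := max N' (max N₁ N₂) with hN
  refine ⟨fun s hs => (h₁ s hs).1, (2 * M₁ + M₂) * 2 ^ α, (1 / 2) ^ N, by positivity, by positivity,
    fun s hs u hsu hu0 hu a b ha hb => ?_⟩
  -- The scale satisfies $2^{-(n+1)}<|u|\le 2^{-n}$; replacing $2^{-n}$ by $2|u|$ produces the
  -- factor $2^\alpha$.
  obtain ⟨n, hn1, hn2⟩ := exists_nat_pow_near_of_lt_one (abs_pos.2 hu0)
    (hu.trans (pow_le_one₀ (by norm_num) (by norm_num))) (by norm_num : (0 : ℝ) < 1 / 2)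
    (by norm_num)
  have hnN : N ≤ n := by
    by_contra! hlt
    have : (1 / 2 : ℝ) ^ N ≤ (1 / 2) ^ (n + 1) :=
      pow_le_pow_of_le_one (by norm_num) (by norm_num) hlt
    linarith
  set m := A * n with hm
  have hnm : n ≤ m := Nat.le_mul_of_pos_left n hA
  have hN1 : N₁ ≤ m := ((le_max_left _ _).trans (le_max_right _ _)).trans (hnN.trans hnm)
  have hN2 : N₂ ≤ n := ((le_max_right _ _).trans (le_max_right _ _)).trans hnN
  have hN'm : N' ≤ m := (le_max_left _ _).trans (hnN.trans hnm)
  have hin : ∀ x ∈ Metric.closedBall q (R / 2), dyadicFloor m x ∈ Metric.closedBall q R := by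
    intro x hx
    have h1 : (1 / 2 : ℝ) ^ m ≤ (1 / 2) ^ N' :=
      pow_le_pow_of_le_one (by norm_num) (by norm_num) hN'm
    rw [Metric.mem_closedBall] at hx ⊢
    linarith [dist_triangle (dyadicFloor m x) x q, dist_dyadicFloor_le m x]
  have hga : g ^ m ≤ ((1 / 2 : ℝ) ^ α) ^ n := by
    rw [hm, pow_mul]; gcongr
  have hA1 : |f (dyadicFloor m s) - a| ≤ M₁ * ((1 / 2 : ℝ) ^ α) ^ n :=
    ((h₁ s hs).2 a ha m hN1).trans (by gcongr)
  have hB1 : |f (dyadicFloor m (s + u • e i)) - b| ≤ M₁ * ((1 / 2 : ℝ) ^ α) ^ n :=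
    ((h₁ _ hsu).2 b hb m hN1).trans (by gcongr)
  set c : ℤ := ⌊2 ^ m * (s i + u)⌋ - ⌊2 ^ m * s i⌋ with hc
  have ec : dyadicFloor m (s + u • e i) = dyadicFloor m s + ((c : ℝ) / 2 ^ m) • e i := by
    ext j
    rw [add_smul_e_apply]
    simp only [dyadicFloor, dyadicPoint_apply, add_smul_e_apply]
    by_cases hj : j = i
    · subst hj
      simp only [if_true, hc]; push_cast; ring
    · simp [hj]
  have hcu : |(c : ℝ) / 2 ^ m| ≤ 2 * (1 / 2) ^ n := by
    have h2m : (0 : ℝ) < 2 ^ m := by positivity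
    have h1 : |(c : ℝ)| ≤ 2 ^ m * |u| + 1 := by
      have e1 := Int.floor_le (2 ^ m * (s i + u))
      have e2 := Int.lt_floor_add_one (2 ^ m * (s i + u))
      have e3 := Int.floor_le (2 ^ m * s i)
      have e4 := Int.lt_floor_add_one (2 ^ m * s i)
      have e5 : 2 ^ m * u ≤ 2 ^ m * |u| := by gcongr; exact le_abs_self u
      have e6 : 2 ^ m * (-u) ≤ 2 ^ m * |u| := by gcongr; exact neg_le_abs u
      rw [hc, abs_le]; push_cast
      constructor <;> linarith
    have h3 : (1 / 2 : ℝ) ^ m ≤ (1 / 2) ^ n :=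
      pow_le_pow_of_le_one (by norm_num) (by norm_num) hnm
    have h4 : (1 / 2 : ℝ) ^ m = 1 / 2 ^ m := by rw [div_pow, one_pow]
    rw [abs_div, abs_of_pos h2m]
    calc |(c : ℝ)| / 2 ^ m ≤ (2 ^ m * |u| + 1) / 2 ^ m := by gcongr
      _ = |u| + (1 / 2) ^ m := by rw [h4]; field_simp
      _ ≤ _ := by linarith
  have hC := h₂ n hN2 (fun j => ⌊2 ^ m * s j⌋) c (hin s hs)
    (by have := hin _ hsu; rw [ec] at this; exact this) hcu
  change |f (dyadicFloor m s + ((c : ℝ) / 2 ^ m) • e i) - f (dyadicFloor m s)| ≤ _ at hC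
  rw [← ec] at hC
  have hpow : ((1 / 2 : ℝ) ^ α) ^ n ≤ 2 ^ α * |u| ^ α := by
    rw [← Real.mul_rpow (by norm_num) (abs_nonneg u), ← Real.rpow_natCast, ← Real.rpow_mul
      (by norm_num), mul_comm α, Real.rpow_mul (by norm_num), Real.rpow_natCast]
    refine Real.rpow_le_rpow (by positivity) ?_ hα
    rw [pow_succ] at hn1; linarith
  calc |b - a| = |(f (dyadicFloor m (s + u • e i)) - f (dyadicFloor m s))
        - (f (dyadicFloor m (s + u • e i)) - b) + (f (dyadicFloor m s) - a)| := by ring_nf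
    _ ≤ |f (dyadicFloor m (s + u • e i)) - f (dyadicFloor m s)|
        + |f (dyadicFloor m (s + u • e i)) - b| + |f (dyadicFloor m s) - a| :=
        (abs_add_le _ _).trans (add_le_add_left (abs_sub _ _) _)
    _ ≤ (2 * M₁ + M₂) * ((1 / 2 : ℝ) ^ α) ^ n := by linarith
    _ ≤ (2 * M₁ + M₂) * (2 ^ α * |u| ^ α) := by gcongr
    _ = _ := by ring

/-! ### Almost sure regularity on balls and agreement with the field. -/

section Sample

variable {Ω : Type*} [MeasurableSpace Ω] {P : Measure Ω} {T : Set Plane}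
  {H : Fin 2 → Plane → ℝ} {L : Fin 2 → Fin 2 → Plane → ℝ} {X : Plane → Ω → ℝ}

theorem MemClass.ae_dyadicLimitHolder (hX : MemClass P T H L X)
    (hL : ∀ i j, i ≠ j → ∀ t ∈ T, L i j t = 0) {Δ₀ : ℝ} (hΔ₀ : 0 < Δ₀)
    (hmom : MomentsComparable P T Δ₀ X) {q : Plane} {R : ℝ} (hR : 0 < R)
    (hKT : Metric.closedBall q R ⊆ T) (i : Fin 2) {α : ℝ} (hα0 : 0 ≤ α)
    (hα : ∀ s ∈ Metric.closedBall q R, α < H i s) :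
    ∀ᵐ ω ∂P, DyadicLimitHolder (fun s => X s ω) q R i α := by
  have hK := isCompact_closedBall q R
  have hKc := convex_closedBall q R
  choose h hh0 hh using fun j => hX.exists_lt_forall_le hK hKT j (a := 0)
    fun s hs => (hX.H_mem j s (hKT hs)).1
  set a := min (h 0) (h 1) / 2 with ha
  have hmin : 0 < min (h 0) (h 1) := lt_min (hh0 0) (hh0 1)
  have ha0 : 0 < a := half_pos hmin
  have hlt : ∀ j, ∀ s ∈ Metric.closedBall q R, a < H j s := by
    intro j s hs
    have h1 : min (h 0) (h 1) ≤ h j := by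
      fin_cases j
      · exact min_le_left _ _
      · exact min_le_right _ _
    linarith [hh j s hs]
  -- This gives $(2^{-a})^{A+1}\le 2^{-\alpha}$; using `A + 1` also ensures a positive refinement
  -- factor.
  obtain ⟨A, hA⟩ := exists_nat_ge (α / a)
  have hgrid := ae_all_iff.2 fun j =>
    hX.ae_gridHolder hL hΔ₀ hmom hK hKc hKT j ha0.le (hlt j) 1
  filter_upwards [hgrid, hX.ae_gridHolder hL hΔ₀ hmom hK hKc hKT i hα0 hα (A + 1)] with ω h1 h2
  refine dyadicLimitHolder_of_gridHolder hR (by positivity)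
    (Real.rpow_lt_one (by norm_num) (by norm_num) ha0) h1 i (Nat.le_add_left 1 A) hα0 ?_ h2
  rw [← Real.rpow_natCast, ← Real.rpow_mul (by norm_num)]
  refine Real.rpow_le_rpow_of_exponent_ge (by norm_num) (by norm_num) ?_
  rw [div_le_iff₀ ha0] at hA
  push_cast
  linarith

theorem MemClass.ae_tendsto_increment (hX : MemClass P T H L X)
    (hL : ∀ i j, i ≠ j → ∀ t ∈ T, L i j t = 0) {Δ₀ : ℝ} (hΔ₀ : 0 < Δ₀)
    (hmom : MomentsComparable P T Δ₀ X) {K : Set Plane} (hK : IsCompact K) (hKc : Convex ℝ K)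
    (hKT : K ⊆ T) (i : Fin 2) (x : ℕ → Plane) (u : ℕ → ℝ) (hx : ∀ n, x n ∈ K)
    (hxu : ∀ n, x n + u n • e i ∈ K) (hu : ∀ n, |u n| ≤ 2 * (1 / 2) ^ n) :
    ∀ᵐ ω ∂P, Tendsto (fun n => X (x n + u n • e i) ω - X (x n) ω) atTop (𝓝 0) := by
  obtain ⟨h, hh0, hh⟩ := hX.exists_lt_forall_le hK hKT i (a := 0)
    fun s hs => (hX.H_mem i s (hKT hs)).1
  obtain ⟨g, hg, hg1⟩ := exists_between
    (Real.rpow_lt_one (by norm_num) (by norm_num) hh0 : (1 / 2 : ℝ) ^ h < 1)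
  have hg0 : 0 ≤ g := (Real.rpow_nonneg (by norm_num) h).trans hg.le
  have key := hX.ae_increment_le hL hΔ₀ hmom hK hKc hKT i hh0 hh hg
    (fun _ => ({()} : Finset Unit)) (fun n _ => x n) (fun n _ => u n) (D := 1) (B := 1)
    (by norm_num) (by norm_num) (by simp) (fun n _ _ => hx n) (fun n _ _ => hxu n)
    (fun n _ _ => hu n)
  filter_upwards [key] with ω ⟨M, N, _, hb⟩
  refine squeeze_zero_norm' (a := fun n => M * g ^ n) ?_ ?_
  · filter_upwards [eventually_ge_atTop N] with n hn
    exact hb n hn () (by simp)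
  · simpa using (tendsto_pow_atTop_nhds_zero_of_lt_one hg0 hg1).const_mul M

/-- The corner is reached from `t` by one step in each direction, and both increments tend to 0
almost surely. -/
theorem MemClass.ae_tendsto_dyadicFloor (hX : MemClass P T H L X) (hT : IsOpen T)
    (hL : ∀ i j, i ≠ j → ∀ t ∈ T, L i j t = 0) {Δ₀ : ℝ} (hΔ₀ : 0 < Δ₀)
    (hmom : MomentsComparable P T Δ₀ X) {t : Plane} (ht : t ∈ T) :
    ∀ᵐ ω ∂P, Tendsto (fun n => X (dyadicFloor n t) ω) atTop (𝓝 (X t ω)) := by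
  obtain ⟨R, hR, hKT⟩ := Metric.nhds_basis_closedBall.mem_iff.1 (hT.mem_nhds ht)
  have hK := isCompact_closedBall t R
  have hKc := convex_closedBall t R
  obtain ⟨N, hN⟩ := exists_pow_lt_of_lt_one (half_pos hR) (by norm_num : (1 / 2 : ℝ) < 1)
  -- The shift by `N` keeps the whole path in the ball from the first index on.
  let v : ℕ → Fin 2 → ℝ := fun n j => dyadicFloor (n + N) t j - t j
  let w : ℕ → Plane := fun n => t + v n 0 • e 0
  have hv : ∀ n j, |v n j| ≤ (1 / 2) ^ (n + N) := by
    intro n j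
    have h2 : (0 : ℝ) < 2 ^ (n + N) := by positivity
    have h1 : v n j = ((⌊2 ^ (n + N) * t j⌋ : ℝ) - 2 ^ (n + N) * t j) * (1 / 2) ^ (n + N) := by
      simp only [v, dyadicFloor, dyadicPoint_apply, one_div, inv_pow]; field_simp
    rw [h1, abs_mul, abs_of_pos (a := (1 / 2 : ℝ) ^ (n + N)) (by positivity)]
    exact mul_le_of_le_one_left (by positivity) (abs_floor_sub_le _)
  have hvu : ∀ n j, |v n j| ≤ 2 * (1 / 2) ^ n := by
    intro n j
    have h1 : (1 / 2 : ℝ) ^ (n + N) ≤ (1 / 2) ^ n :=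
      pow_le_pow_of_le_one (by norm_num) (by norm_num) (Nat.le_add_right n N)
    have h2 : (0 : ℝ) < (1 / 2) ^ n := by positivity
    linarith [hv n j]
  have hmem : ∀ n (x : Plane), (∀ j, |x j - t j| ≤ (1 / 2) ^ (n + N)) →
      x ∈ Metric.closedBall t R := by
    intro n x hx
    have h1 : (1 / 2 : ℝ) ^ (n + N) ≤ (1 / 2) ^ N :=
      pow_le_pow_of_le_one (by norm_num) (by norm_num) (Nat.le_add_left N n)
    rw [Metric.mem_closedBall]
    linarith [dist_le_of_forall_coord hx]
  have hw : ∀ n, w n ∈ Metric.closedBall t R := fun n => hmem n _ fun j => by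
    simp only [w, add_smul_e_apply, add_sub_cancel_left]
    split_ifs
    · exact hv n 0
    · simp
  have hwv : ∀ n, w n + v n 1 • e 1 = dyadicFloor (n + N) t := by
    intro n
    ext j
    simp only [w, add_smul_e_apply]
    fin_cases j <;> simp [v]
  have h0 := hX.ae_tendsto_increment hL hΔ₀ hmom hK hKc hKT 0 (fun _ => t) (fun n => v n 0)
    (fun _ => Metric.mem_closedBall_self hR.le) hw (fun n => hvu n 0)
  have h1 := hX.ae_tendsto_increment hL hΔ₀ hmom hK hKc hKT 1 w (fun n => v n 1) hw
    (fun n => by rw [hwv]; exact hmem n _ (hv n)) (fun n => hvu n 1)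
  filter_upwards [h0, h1] with ω h0 h1
  rw [← tendsto_add_atTop_iff_nat N]
  have h2 := (h0.add h1).add_const (X t ω)
  simp only [zero_add] at h2
  refine h2.congr fun n => ?_
  rw [hwv]
  simp only [w]
  ring

end Sample

/-! ### From countably many balls to all points and exponents. -/

theorem locallyHolderInDirection_of_dyadicLimitHolder {T : Set Plane} {f F : Plane → ℝ}
    {q t : Plane} {R α β : ℝ} {i : Fin 2} (hR : 0 < R) (ht : dist t q < R / 4)
    (hKT : Metric.closedBall q R ⊆ T) (hαβ : α < β)
    (hf : DyadicLimitHolder f q R i β)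
    (hF : ∀ s ∈ T, (∃ l, Tendsto (fun n => f (dyadicFloor n s)) atTop (𝓝 l)) →
      Tendsto (fun n => f (dyadicFloor n s)) atTop (𝓝 (F s))) :
    LocallyHolderInDirection T F i α t := by
  obtain ⟨hlim, M, δ, hδ, hM, hb⟩ := hf
  have hball : ∀ s ∈ Metric.closedBall q (R / 2),
      Tendsto (fun n => f (dyadicFloor n s)) atTop (𝓝 (F s)) := fun s hs =>
    hF s (hKT (Metric.closedBall_subset_closedBall (by linarith) hs)) (hlim s hs)
  -- The three radii keep points in the half ball, force $|u|\le\delta$, and force $|u|\le1$ so that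
  -- the exponent may drop from `β` to `α`.
  refine ⟨min (R / 4) (min (δ / 2) (1 / 2)), by positivity, M, fun s hs u hsu => ?_⟩
  rcases eq_or_ne u 0 with rfl | hu
  · simp only [zero_smul, add_zero, sub_self, abs_zero]
    positivity
  have hin : ∀ x ∈ Metric.ball t (min (R / 4) (min (δ / 2) (1 / 2))),
      x ∈ Metric.closedBall q (R / 2) := by
    intro x hx
    rw [Metric.mem_ball] at hx
    rw [Metric.mem_closedBall]
    linarith [dist_triangle x t q, hx.trans_le (min_le_left _ _)]
  have hd : |u| ≤ 2 * min (R / 4) (min (δ / 2) (1 / 2)) := by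
    have h1 : dist (s + u • e i) s = |u| := by
      rw [dist_eq_norm, add_sub_cancel_left, norm_smul, e, PiLp.norm_single]
      simp
    rw [← h1]
    have h2 := Metric.mem_ball.1 hs.1
    have h3 := Metric.mem_ball.1 hsu.1
    linarith [dist_triangle_right (s + u • e i) s t]
  have hd1 : min (R / 4) (min (δ / 2) (1 / 2)) ≤ δ / 2 := (min_le_right _ _).trans (min_le_left _ _)
  have hd2 : min (R / 4) (min (δ / 2) (1 / 2)) ≤ 1 / 2 :=
    (min_le_right _ _).trans (min_le_right _ _)
  refine (hb s (hin s hs.1) u (hin _ hsu.1) hu (by linarith) _ _ (hball s (hin s hs.1))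
    (hball _ (hin _ hsu.1))).trans ?_
  gcongr M * ?_
  exact Real.rpow_le_rpow_of_exponent_ge (abs_pos.2 hu) (by linarith) hαβ.le

/-- Quantifying over `F` inside the almost sure event lets one null set serve both the constructed
modification and a continuous path of `X`. -/
theorem MemClass.ae_forall_locallyHolderInDirection {Ω : Type*} [MeasurableSpace Ω]
    {P : Measure Ω} {T : Set Plane}
    {H : Fin 2 → Plane → ℝ} {L : Fin 2 → Fin 2 → Plane → ℝ} {X : Plane → Ω → ℝ}
    (hX : MemClass P T H L X) (hT : IsOpen T)
    (hL : ∀ i j, i ≠ j → ∀ t ∈ T, L i j t = 0) {Δ₀ : ℝ} (hΔ₀ : 0 < Δ₀)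
    (hmom : MomentsComparable P T Δ₀ X) :
    ∀ᵐ ω ∂P, ∀ F : Plane → ℝ,
      (∀ s ∈ T, (∃ l, Tendsto (fun n => X (dyadicFloor n s) ω) atTop (𝓝 l)) →
        Tendsto (fun n => X (dyadicFloor n s) ω) atTop (𝓝 (F s))) →
      ∀ t ∈ T, ∀ i, ∀ α : ℝ, 0 ≤ α → α < H i t → LocallyHolderInDirection T F i α t := by
  let q := TopologicalSpace.denseSeq Plane
  have key : ∀ᵐ ω ∂P, ∀ (k l : ℕ) (i : Fin 2) (β : ℚ),
      (Metric.closedBall (q k) (1 / (l + 1)) ⊆ T ∧ (0 : ℝ) ≤ β ∧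
        ∀ s ∈ Metric.closedBall (q k) (1 / (l + 1)), (β : ℝ) < H i s) →
      DyadicLimitHolder (fun s => X s ω) (q k) (1 / (l + 1)) i β := by
    simp only [ae_all_iff]
    intro k l i β
    exact fun h => hX.ae_dyadicLimitHolder hL hΔ₀ hmom (by positivity) h.1 i h.2.1 h.2.2
  filter_upwards [key] with ω hω F hF t ht i α hα0 hα
  obtain ⟨β, hαβ, hβ⟩ := exists_rat_btwn hα
  have hcont : ContinuousAt (H i) t :=
    (hX.H_contDiffOn i).continuousOn.continuousAt (hT.mem_nhds ht)
  obtain ⟨ε, hε, hball⟩ := Metric.mem_nhds_iff.1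
    (Filter.inter_mem (hT.mem_nhds ht) (hcont.eventually_const_lt hβ))
  obtain ⟨l, hl⟩ := exists_nat_one_div_lt (half_pos hε)
  have hR : (0 : ℝ) < 1 / (l + 1) := by positivity
  obtain ⟨k, hk⟩ := (TopologicalSpace.denseRange_denseSeq Plane).exists_dist_lt t
    (div_pos hR (by norm_num : (0 : ℝ) < 4))
  have hsub : ∀ s ∈ Metric.closedBall (q k) (1 / (l + 1)), s ∈ Metric.ball t ε := by
    intro s hs
    rw [Metric.mem_closedBall] at hs
    rw [Metric.mem_ball]
    have := dist_triangle_right s t (q k)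
    simp only [q] at *
    linarith
  have hKT : Metric.closedBall (q k) (1 / ((l : ℝ) + 1)) ⊆ T := fun s hs => (hball (hsub s hs)).1
  exact locallyHolderInDirection_of_dyadicLimitHolder hR hk hKT hαβ
    (hω k l i β ⟨hKT, hα0.trans hαβ.le, fun s hs => (hball (hsub s hs)).2⟩) hF

end LocalRegularity

theorem mainTheorem6 {Ω : Type*} [MeasurableSpace Ω] (P : Measure Ω) [IsProbabilityMeasure P]
    (T : Set LocalRegularity.Plane) (hT : IsOpen T)
    (H : Fin 2 → LocalRegularity.Plane → ℝ)
    (L : Fin 2 → Fin 2 → LocalRegularity.Plane → ℝ)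
    (hL : ∀ i j, i ≠ j → ∀ t ∈ T, L i j t = 0)
    (X : LocalRegularity.Plane → Ω → ℝ)
    (hX : LocalRegularity.MemClass P T H L X)
    (Δ₀ : ℝ) (hΔ₀ : 0 < Δ₀)
    (hmom : LocalRegularity.MomentsComparable P T Δ₀ X) :
    (∃ Y : LocalRegularity.Plane → Ω → ℝ,
      (∀ t ∈ T, Y t =ᵐ[P] X t) ∧
      ∀ᵐ ω ∂P, ∀ t ∈ T, ∀ i, ∀ α : ℝ, 0 ≤ α → α < H i t →
        LocalRegularity.LocallyHolderInDirection T (fun s => Y s ω) i α t) ∧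
    ((∀ᵐ ω ∂P, ContinuousOn (fun s => X s ω) T) →
      ∀ᵐ ω ∂P, ∀ t ∈ T, ∀ i, ∀ α : ℝ, 0 ≤ α → α < H i t →
        LocalRegularity.LocallyHolderInDirection T (fun s => X s ω) i α t) := by
  have hae := hX.ae_forall_locallyHolderInDirection hT hL hΔ₀ hmom
  constructor
  -- Where the limit does not exist the value is arbitrary, which is harmless: the criterion
  -- constrains `F` only where it does.
  · refine ⟨fun s ω => Filter.limUnder Filter.atTop fun n => X (LocalRegularity.dyadicFloor n s) ω,
      fun t ht => ?_, ?_⟩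
    · filter_upwards [hX.ae_tendsto_dyadicFloor hT hL hΔ₀ hmom ht] with ω hω
      exact hω.limUnder_eq
    · filter_upwards [hae] with ω hω
      exact hω _ fun s _ hs => tendsto_nhds_limUnder hs
  · intro hcont
    filter_upwards [hae, hcont] with ω hω hc
    exact hω _ fun s hs _ => ((hc.continuousAt (hT.mem_nhds hs)).tendsto).comp
      (LocalRegularity.tendsto_dyadicFloor s)
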